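/- Let $\mathrm{Aut}(\mathbb{Q})$ be the group of order-preserving permutations of $(\mathbb{Q},<)$, equipped with the topology of pointwise convergence on the discrete set $\mathbb{Q}$ (a basis of neighbourhoods of the identity is formed by the pointwise stabilizers of finite subsets of $\mathbb{Q}$). A unitary representation of $\mathrm{Aut}(\mathbb{Q})$ is a homomorphism $\pi$ from $\mathrm{Aut}(\mathbb{Q})$ to the unitary group of a complex Hilbert space $\mathcal{H}$ such that $g \mapsto \pi(g)\xi$ is continuous for every $\xi \in \mathcal{H}$; it is irreducible if $\mathcal{H} \neq 0$ and $0$ and $\mathcal{H}$ are the only closed $\pi$-invariant subspaces. For $n \in \mathbb{N} = \{0,1,2,\dots\}$ let $\mathbb{Q}^{[n]}$ be the set of all subsets of $\mathbb{Q}$ of size $n$, and let $\mathrm{Aut}(\mathbb{Q})$ act on $\ell^2(\mathbb{Q}^{[n]})$ (complex-valued square-summable functions) by $(g\cdot f)(A) = f(g^{-1}A)$. Then, up to unitary equivalence, the irreducible unitary representations of $\mathrm{Aut}(\mathbb{Q})$ are exactly the representations on $\ell^2(\mathbb{Q}^{[n]})$, $n \in \mathbb{N}$, one for each $n$. That is: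 (1) for every $n \in \mathbb{N}$ the representation on $\ell^2(\mathbb{Q}^{[n]})$ is an irreducible unitary representation; (2) for $m \neq n$ the representations on $\ell^2(\mathbb{Q}^{[m]})$ and $\ell^2(\mathbb{Q}^{[n]})$ are not unitarily equivalent; (3) every irreducible unitary representation of $\mathrm{Aut}(\mathbb{Q})$ (on a complex Hilbert space of any dimension) is unitarily equivalent to the representation on $\ell^2(\mathbb{Q}^{[n]})$ for some $n \in \mathbb{N}$. -/

import Mathlib

/-- `Aut(ℚ, <)`, the group of order automorphisms of the rationals (the product is composition). -/
abbrev AutQ : Type := ℚ ≃o ℚ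

/-- The topology of `Aut(ℚ, <)` as a permutation group: pointwise convergence on the *discrete*
set `ℚ`. A basis at the identity is given by the pointwise stabilizers of the finite subsets. -/
instance AutQ.instTopologicalSpace : TopologicalSpace AutQ :=
  TopologicalSpace.induced (fun (g : AutQ) (q : ℚ) => g q)
    (@Pi.topologicalSpace ℚ (fun _ => ℚ) (fun _ => ⊥))

/-! ### Unitary representations

Without continuity, a unitary representation of `G` on a complex Hilbert space `H` is a
homomorphism `π : G →* (H ≃ₗᵢ[ℂ] H)`. -/

section UnitaryReps

variable {G : Type*} [Group G]
variable {H : Type*} [NormedAddCommGroup H] [InnerProductSpace ℂ H]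
variable {H' : Type*} [NormedAddCommGroup H'] [InnerProductSpace ℂ H']

/-- Strong continuity: all orbit maps `g ↦ π(g)ξ` are continuous. -/
def IsStronglyContinuous [TopologicalSpace G] (π : G →* (H ≃ₗᵢ[ℂ] H)) : Prop :=
  ∀ ξ : H, Continuous fun g : G => π g ξ

/-- `π` is irreducible: its space is nonzero, and the only closed invariant subspaces are
`0` and the whole space. -/
def IsIrreducibleRep (π : G →* (H ≃ₗᵢ[ℂ] H)) : Prop :=
  Nontrivial H ∧
    ∀ K : Submodule ℂ H, IsClosed (K : Set H) → (∀ g : G, ∀ ξ ∈ K, π g ξ ∈ K) → K = ⊥ ∨ K = ⊤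

/-- Unitary equivalence of representations. -/
def AreUnitarilyEquivalent (π : G →* (H ≃ₗᵢ[ℂ] H)) (ρ : G →* (H' ≃ₗᵢ[ℂ] H')) : Prop :=
  ∃ U : H ≃ₗᵢ[ℂ] H', ∀ (g : G) (ξ : H), U (π g ξ) = ρ g (U ξ)

end UnitaryReps

/-! ### The representation on `ℓ²(Y)` attached to an action on a set `Y` -/

section QuasiRegular

/-- The Hilbert space `ℓ²(Y)` of square summable complex functions on the set `Y`. -/
abbrev EllTwo (Y : Type*) : Type _ := lp (fun _ : Y => ℂ) 2

variable {G : Type*} [Group G] {Y : Type*} [MulAction G Y]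

theorem EllTwo.memℓp_translate (g : G) (f : EllTwo Y) :
    Memℓp (fun y : Y => f (g⁻¹ • y)) 2 := by
  refine memℓp_gen ?_
  exact (MulAction.toPerm (g⁻¹) : Equiv.Perm Y).summable_iff.mpr
    ((lp.memℓp f).summable (by norm_num))

/-- Translation of a square summable function: `(g · f)(y) = f(g⁻¹ y)`. -/
def EllTwo.translate (g : G) (f : EllTwo Y) : EllTwo Y :=
  ⟨fun y => f (g⁻¹ • y), EllTwo.memℓp_translate g f⟩

theorem EllTwo.translate_apply (g : G) (f : EllTwo Y) (y : Y) : EllTwo.translate g f y = f (g⁻¹ • y) := rfl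

theorem EllTwo.translate_mul (g h : G) (f : EllTwo Y) :
    EllTwo.translate (g * h) f = EllTwo.translate g (EllTwo.translate h f) := by
  ext y
  simp only [EllTwo.translate_apply, mul_inv_rev, mul_smul]

theorem EllTwo.translate_one (f : EllTwo Y) : EllTwo.translate (1 : G) f = f := by
  ext y
  simp only [EllTwo.translate_apply, inv_one, one_smul]

theorem EllTwo.norm_translate (g : G) (f : EllTwo Y) : ‖EllTwo.translate g f‖ = ‖f‖ := by
  rw [lp.norm_eq_tsum_rpow (by norm_num), lp.norm_eq_tsum_rpow (by norm_num)]
  congr 1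
  exact (MulAction.toPerm (g⁻¹) : Equiv.Perm Y).tsum_eq
    (fun y => ‖f y‖ ^ (2 : ENNReal).toReal)

variable (G Y) in
/-- The representation of `G` on `ℓ²(Y)` given by `(g · f)(y) = f(g⁻¹ y)`. For a transitive action
this is the quasi-regular representation `ℓ²(G/V)`, where `V` is a point stabilizer. -/
def quasiRegularRep :
    G →* (EllTwo Y ≃ₗᵢ[ℂ] EllTwo Y) where
  toFun g :=
    { toFun := EllTwo.translate g
      invFun := EllTwo.translate g⁻¹
      map_add' := fun _ _ => rfl
      map_smul' := fun _ _ => rfl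
      left_inv := fun f => by rw [← EllTwo.translate_mul, inv_mul_cancel, EllTwo.translate_one]
      right_inv := fun f => by rw [← EllTwo.translate_mul, mul_inv_cancel, EllTwo.translate_one]
      norm_map' := EllTwo.norm_translate g }
  map_one' := by
    ext1 f
    exact EllTwo.translate_one f
  map_mul' g h := by
    ext1 f
    exact EllTwo.translate_mul g h f

end QuasiRegular

/-- The representation of `Aut(ℚ, <)` on `ℓ²(ℚ^[n])`, where `ℚ^[n]` is the set of subsets of `ℚ`
of size `n`, on which `Aut(ℚ, <)` acts by taking images: `g • A = {g a | a ∈ A}`. -/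
noncomputable def repQ (n : ℕ) :
    AutQ →* (EllTwo (Set.powersetCard ℚ n) ≃ₗᵢ[ℂ] EllTwo (Set.powersetCard ℚ n)) :=
  quasiRegularRep AutQ (Set.powersetCard ℚ n)

/-! Everything rests on vectors fixed by pointwise stabilizers of finite sets. In ℓ²(ℚ^[n]), a
vector fixed by the stabilizer of `A` is constant along infinite orbits, hence supported on subsets
of `A` (`subset_of_apply_ne_zero`). For |A| = n only multiples of δ_A remain, which yields
irreducibility; comparing sizes separates different n.

Conversely, for irreducible π, continuity and a convexity argument give a nonzero vector fixed by
some finite stabilizer. Take `A` of least size n, with a unit fixed vector ξ. Since g • A = A forces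
g to fix `A` pointwise, gξ depends only on gA. Distinct translates are orthogonal: for a ∈ A and C =
A \ {a}, the product ⟨hξ, gξ⟩ with g, h fixing C and ga < ha is a constant, which is zero because 0
lies in the closed convex hull of the orbit by minimality (`inner_translate_self_eq_zero`); Bessel's
inequality then handles arbitrary pairs (`inner_eq_zero_of_not_subset`). By irreducibility the
translates form a Hilbert basis, permuted as ℚ^[n]. -/

open scoped Pointwise

/-! ### Topology of pointwise convergence -/

section PointwiseConvergence

variable {G X Y : Type*} [TopologicalSpace Y]

/-- Stated for an abstract discrete space, so that it can be applied to ℚ with the topology `⊥`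
instead of its usual one. -/
theorem isOpen_induced_setOf_apply_eq [DiscreteTopology Y] (e : G → X → Y) (x : X) (y : Y) :
    @IsOpen G (TopologicalSpace.induced e Pi.topologicalSpace) {g | e g x = y} :=
  isOpen_induced_iff.2 ⟨{f | f x = y}, (isOpen_discrete ({y} : Set Y)).preimage
    (continuous_apply (A := fun _ : X => Y) x), rfl⟩

theorem exists_finset_of_isOpen_induced (e : G → X → Y) {U : Set G}
    (hU : @IsOpen G (TopologicalSpace.induced e Pi.topologicalSpace) U) {g₀ : G} (h₀ : g₀ ∈ U) :
    ∃ A : Finset X, ∀ g, (∀ a ∈ A, e g a = e g₀ a) → g ∈ U := by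
  obtain ⟨V, hV, rfl⟩ := isOpen_induced_iff.1 hU
  obtain ⟨I, u, hu, hI⟩ := isOpen_pi_iff.1 hV _ h₀
  refine ⟨I, fun g hg => hI fun q hq => ?_⟩
  rw [hg q hq]
  exact (hu q hq).2

end PointwiseConvergence

/-! ### Homogeneity of (ℚ, <) and stabilizers of finite sets -/

namespace AutQ

/-- The pointwise stabilizer of a finite set of rationals. -/
abbrev pointStab (A : Finset ℚ) : Subgroup AutQ := fixingSubgroup AutQ (A : Set ℚ)

theorem mem_pointStab {A : Finset ℚ} {g : AutQ} : g ∈ pointStab A ↔ ∀ a ∈ A, g a = a := by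
  simp [pointStab, mem_fixingSubgroup_iff, RelIso.smul_def]

theorem pointStab_anti {A B : Finset ℚ} (h : A ⊆ B) : pointStab B ≤ pointStab A := fun _ hg =>
  mem_pointStab.2 fun a ha => mem_pointStab.1 hg a (h ha)

open Order Order.PartialIso in
/-- Every finite partial isomorphism of `(ℚ, <)` extends to an automorphism. -/
theorem exists_extend_partialIso (p : PartialIso ℚ ℚ) : ∃ g : AutQ, ∀ x ∈ p.val, g x.1 = x.2 := by
  -- Back-and-forth: an ideal of partial isomorphisms containing `p` and meeting each condition
  -- "defined at q", on both sides.
  let toCofinal : ℚ ⊕ ℚ → Cofinal (PartialIso ℚ ℚ) := fun q =>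
    Sum.recOn q (definedAtLeft ℚ) (definedAtRight ℚ)
  let I : Ideal (PartialIso ℚ ℚ) := idealOfCofinals p toCofinal
  let F a := funOfIdeal a I (cofinal_meets_idealOfCofinals _ toCofinal (Sum.inl a))
  let G b := invOfIdeal b I (cofinal_meets_idealOfCofinals _ toCofinal (Sum.inr b))
  refine ⟨OrderIso.ofCmpEqCmp (fun a => (F a).val) (fun b => (G b).val) fun a b => ?_,
    fun x hx => ?_⟩
  · rcases (F a).prop with ⟨f, hf, ha⟩
    rcases (G b).prop with ⟨g, hg, hb⟩
    rcases I.directed _ hf _ hg with ⟨m, _, fm, gm⟩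
    exact m.prop (a, _) (fm ha) (_, b) (gm hb)
  · change (F x.1).val = x.2
    rcases (F x.1).prop with ⟨f, hf, ha⟩
    rcases I.directed _ hf _ (mem_idealOfCofinals p toCofinal) with ⟨m, _, fm, gm⟩
    have h := m.prop _ (fm ha) _ (gm hx)
    rw [cmp_self_eq_eq] at h
    exact cmp_eq_eq_iff _ _ |>.1 h.symm

/-- Every strictly increasing map on a finite set of rationals extends to an automorphism. -/
theorem exists_extend (X : Finset ℚ) (f : ℚ → ℚ) (hf : StrictMonoOn f X) :
    ∃ g : AutQ, ∀ x ∈ X, g x = f x := by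
  obtain ⟨g, hg⟩ := exists_extend_partialIso ⟨X.image fun x => (x, f x), by
    intro p hp q hq
    simp only [Finset.mem_image] at hp hq
    obtain ⟨x, hx, rfl⟩ := hp
    obtain ⟨y, hy, rfl⟩ := hq
    exact (hf.cmp_map_eq hx hy).symm⟩
  exact ⟨g, fun x hx => hg (x, f x) (Finset.mem_image_of_mem _ hx)⟩

/-- Two rationals with the same cut over a finite set are conjugate under its stabilizer. -/
theorem exists_map_of_same_cut (C : Finset ℚ) {x y : ℚ} (hx : x ∉ C) (hy : y ∉ C)
    (h : ∀ c ∈ C, c < x ↔ c < y) : ∃ g ∈ pointStab C, g x = y := by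
  obtain ⟨g, hg⟩ := exists_extend (insert x C) (fun z => if z = x then y else z) (by
    intro p hp q hq hpq
    simp only [Finset.coe_insert, Set.mem_insert_iff, Finset.mem_coe] at hp hq
    rcases hp with rfl | hp <;> rcases hq with rfl | hq
    · exact absurd hpq (lt_irrefl _)
    · have h1 : q ≠ p := hpq.ne'
      have h2 : q ≠ y := fun e => hy (e ▸ hq)
      have h3 := h q hq
      simp only [if_true, if_neg h1]
      exact lt_of_le_of_ne (not_lt.1 fun h' => absurd (h3.2 h') hpq.not_gt) h2.symm
    · simp only [if_true, if_neg hpq.ne]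
      exact (h p hp).1 hpq
    · have h1 : p ≠ x := fun e => hx (e ▸ hp)
      have h2 : q ≠ x := fun e => hx (e ▸ hq)
      simpa only [if_neg h1, if_neg h2] using hpq)
  refine ⟨g, mem_pointStab.2 fun a ha => ?_, by simpa using hg x (Finset.mem_insert_self _ _)⟩
  have h1 : a ≠ x := fun e => hx (e ▸ ha)
  simpa [h1] using hg a (Finset.mem_insert_of_mem ha)

/-- A point outside a finite set can be moved to the right by the stabilizer of that set. -/
theorem exists_lt_apply (C : Finset ℚ) {a : ℚ} (ha : a ∉ C) : ∃ h ∈ pointStab C, a < h a := by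
  -- The target `t` lies between `a` and the next point of `C`, so it has the same cut over `C`.
  obtain ⟨t, ht, ht'⟩ := Order.exists_between_finsets {a} (C.filter fun c => a < c) (by simp)
  have hat : a < t := ht a (by simp)
  obtain ⟨h, hh, he⟩ := exists_map_of_same_cut C ha (y := t)
    (fun htC => lt_irrefl t (ht' t (Finset.mem_filter.2 ⟨htC, hat⟩))) (fun c hc =>
      ⟨fun h' => h'.trans hat, fun h' => lt_of_le_of_ne (not_lt.1 fun h2 =>
        absurd (ht' c (Finset.mem_filter.2 ⟨hc, h2⟩)) h'.not_gt) fun e => ha (e ▸ hc)⟩)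
  exact ⟨h, hh, he ▸ hat⟩

/-- Two points to the right of `a` in the same orbit of the stabilizer of `C` are conjugate under
the stabilizer of `C ∪ {a}`. -/
theorem exists_map_insert (C : Finset ℚ) {a : ℚ} (ha : a ∉ C) {u v : AutQ}
    (hu : u ∈ pointStab C) (hv : v ∈ pointStab C) (hau : a < u a) (hav : a < v a) :
    ∃ k ∈ pointStab (insert a C), k (u a) = v a := by
  have key : ∀ w ∈ pointStab C, ∀ c ∈ C, (c < w a ↔ c < a) ∧ w a ≠ c := by
    intro w hw c hc
    have hwc := mem_pointStab.1 hw c hc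
    constructor
    · nth_rw 1 [← hwc]; exact w.lt_iff_lt
    · nth_rw 1 [← hwc]; exact fun e => ha (w.injective e ▸ hc)
  refine exists_map_of_same_cut _ ?_ ?_ ?_
  · simp only [Finset.mem_insert, not_or]
    exact ⟨hau.ne', fun hc => (key u hu _ hc).2 rfl⟩
  · simp only [Finset.mem_insert, not_or]
    exact ⟨hav.ne', fun hc => (key v hv _ hc).2 rfl⟩
  · intro c hc
    rcases Finset.mem_insert.1 hc with rfl | hc
    · exact ⟨fun _ => hav, fun _ => hau⟩
    · rw [(key u hu c hc).1, (key v hv c hc).1]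

theorem lt_pow_apply {h : AutQ} {a : ℚ} (ha : a < h a) {k : ℕ} (hk : 0 < k) : a < (h ^ k) a := by
  induction k with
  | zero => exact absurd hk (lt_irrefl _)
  | succ k ih =>
    rcases Nat.eq_zero_or_pos k with rfl | hk'
    · simpa using ha
    · rw [pow_succ']
      exact ha.trans (h.lt_iff_lt.2 (ih hk'))

/-- An automorphism preserving a finite set of rationals fixes all its points. -/
theorem mem_pointStab_of_smul_eq {A : Finset ℚ} {g : AutQ} (h : g • A = A) : g ∈ pointStab A := by
  rw [mem_pointStab]
  intro a ha
  -- A finite set has only one increasing enumeration, and `g` composed with it is another.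
  have e := Finset.orderEmbOfFin_unique (s := A) rfl (f := fun i => g (A.orderEmbOfFin rfl i))
    (fun i => by
      have := Finset.smul_mem_smul_finset (a := g) (Finset.orderEmbOfFin_mem A rfl i)
      rwa [h] at this)
    (fun i j hij => g.lt_iff_lt.2 ((A.orderEmbOfFin rfl).lt_iff_lt.2 hij))
  have hr : a ∈ Set.range (A.orderEmbOfFin rfl) := by
    rw [Finset.range_orderEmbOfFin]; exact ha
  obtain ⟨i, rfl⟩ := hr
  exact congrFun e i

theorem smul_eq_of_mem_pointStab {n : ℕ} {A : Set.powersetCard ℚ n} {g : AutQ}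
    (h : g ∈ pointStab (A : Finset ℚ)) : g • A = A := by
  apply Subtype.ext
  rw [Set.powersetCard.coe_smul]
  ext x
  rw [Finset.mem_smul_finset]
  constructor
  · rintro ⟨y, hy, rfl⟩
    rwa [RelIso.smul_def, mem_pointStab.1 h y hy]
  · exact fun hx => ⟨x, hx, mem_pointStab.1 h x hx⟩

theorem smul_eq_iff {n : ℕ} {A : Set.powersetCard ℚ n} {g : AutQ} :
    g • A = A ↔ g ∈ pointStab (A : Finset ℚ) :=
  ⟨fun h => mem_pointStab_of_smul_eq (by rw [← Set.powersetCard.coe_smul, h]),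
    smul_eq_of_mem_pointStab⟩

/-- `Aut(ℚ, <)` acts transitively on the `n`-element sets of rationals. -/
theorem exists_smul_eq {n : ℕ} (A B : Set.powersetCard ℚ n) : ∃ g : AutQ, g • A = B := by
  have hA : (A : Finset ℚ).card = n := A.2
  have hB : (B : Finset ℚ).card = n := B.2
  let e := (A : Finset ℚ).orderIsoOfFin hA
  let f : ℚ → ℚ := fun x => if hx : x ∈ (A : Finset ℚ) then
    (B : Finset ℚ).orderEmbOfFin hB (e.symm ⟨x, hx⟩) else 0
  obtain ⟨g, hg⟩ := exists_extend A f (by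
    intro x hx y hy hxy
    have hx' : x ∈ (A : Finset ℚ) := hx
    have hy' : y ∈ (A : Finset ℚ) := hy
    simp only [f, dif_pos hx', dif_pos hy']
    exact ((B : Finset ℚ).orderEmbOfFin hB).lt_iff_lt.2 (e.symm.lt_iff_lt.2 hxy))
  refine ⟨g, Subtype.ext (Finset.eq_of_subset_of_card_le ?_ ?_)⟩
  · intro x hx
    rw [Set.powersetCard.coe_smul, Finset.mem_smul_finset] at hx
    obtain ⟨y, hy, rfl⟩ := hx
    rw [RelIso.smul_def, hg y hy]
    simp only [f, dif_pos hy]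
    exact Finset.orderEmbOfFin_mem _ _ _
  · rw [(g • A).2, hB]

theorem isOpen_setOf_apply_eq (q r : ℚ) : IsOpen {g : AutQ | g q = r} :=
  @isOpen_induced_setOf_apply_eq _ _ _ ⊥ (@DiscreteTopology.mk ℚ ⊥ rfl)
    (fun (g : AutQ) (q : ℚ) => g q) q r

/-- Every neighbourhood of the identity contains the pointwise stabilizer of a finite set. -/
theorem exists_pointStab_subset {U : Set AutQ} (hU : IsOpen U) (h1 : 1 ∈ U) :
    ∃ A : Finset ℚ, ∀ g ∈ pointStab A, g ∈ U := by
  obtain ⟨A, hA⟩ := @exists_finset_of_isOpen_induced _ _ _ ⊥ (fun (g : AutQ) (q : ℚ) => g q) U hU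
    1 h1
  exact ⟨A, fun g hg => hA g (mem_pointStab.1 hg)⟩

end AutQ

theorem rep_mul_apply {G H : Type*} [Group G] [NormedAddCommGroup H] [InnerProductSpace ℂ H]
    (π : G →* (H ≃ₗᵢ[ℂ] H)) (g h : G) (ξ : H) : π (g * h) ξ = π g (π h ξ) := by
  rw [map_mul]
  rfl

/-! ### The representations on ℓ²(ℚ^[n]) -/

section EllTwoReps

open AutQ

theorem repQ_apply (n : ℕ) (g : AutQ) (f : EllTwo (Set.powersetCard ℚ n))
    (B : Set.powersetCard ℚ n) : repQ n g f B = f (g⁻¹ • B) := rfl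

open Classical in
theorem repQ_single (n : ℕ) (g : AutQ) (A : Set.powersetCard ℚ n) :
    repQ n g (lp.single 2 A (1 : ℂ)) = lp.single 2 (g • A) (1 : ℂ) := by
  ext B
  rw [repQ_apply, lp.single_apply, lp.single_apply]
  by_cases h : B = g • A
  · subst h; simp
  · rw [Pi.single_eq_of_ne h, Pi.single_eq_of_ne]
    exact fun h' => h (by rw [← h', smul_inv_smul])

/-- A square summable function on `ℚ^[n]` fixed by the stabilizer of `A` is supported on the
subsets of `A`. -/
theorem subset_of_apply_ne_zero {n : ℕ} {A : Finset ℚ} {f : EllTwo (Set.powersetCard ℚ n)}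
    (hf : ∀ g ∈ pointStab A, repQ n g f = f) {B : Set.powersetCard ℚ n} (hB : f B ≠ 0) :
    (B : Finset ℚ) ⊆ A := by
  by_contra hBA
  obtain ⟨b, hb, hbA⟩ := Finset.not_subset.1 hBA
  obtain ⟨h, hh, hlt⟩ := exists_lt_apply A hbA
  -- The sets h^k • B are pairwise distinct and `f` takes the value f(B) on all of them, so
  -- summability forces f(B) = 0.
  have hconst : ∀ k : ℕ, f (h ^ k • B) = f B := by
    intro k
    conv_rhs => rw [← hf _ (inv_mem (pow_mem hh k)), repQ_apply, inv_inv]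
  have hne : ∀ k : ℕ, 0 < k → h ^ k • B ≠ B := fun k hk e =>
    (lt_pow_apply hlt hk).ne' (mem_pointStab.1 (smul_eq_iff.1 e) b hb)
  have hinj : Function.Injective fun k : ℕ => h ^ k • B := by
    have aux : ∀ j k : ℕ, j < k → h ^ j • B ≠ h ^ k • B := by
      intro j k hjk e
      obtain ⟨d, rfl⟩ := Nat.exists_eq_add_of_lt hjk
      rw [add_assoc, pow_add, mul_smul] at e
      exact hne (d + 1) d.succ_pos (smul_left_cancel _ e).symm
    intro j k e
    rcases lt_trichotomy j k with hjk | hjk | hjk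
    · exact absurd e (aux j k hjk)
    · exact hjk
    · exact absurd e.symm (aux k j hjk)
  have hs := ((lp.memℓp f).summable (by norm_num)).comp_injective hinj
  simp only [Function.comp_def, hconst] at hs
  rw [summable_const_iff] at hs
  norm_num at hs
  exact hB hs

open Classical in
theorem eq_smul_single_of_fixed {n : ℕ} {A : Set.powersetCard ℚ n}
    {f : EllTwo (Set.powersetCard ℚ n)}
    (hf : ∀ g ∈ pointStab (A : Finset ℚ), repQ n g f = f) :
    f = f A • lp.single 2 A (1 : ℂ) := by
  ext B
  rw [lp.coeFn_smul, Pi.smul_apply, lp.single_apply]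
  by_cases h : B = A
  · subst h; simp
  · rw [Pi.single_eq_of_ne h, smul_zero]
    by_contra hB
    exact h (Subtype.ext (Finset.eq_of_subset_of_card_le (subset_of_apply_ne_zero hf hB)
      (by rw [A.2, B.2])))

-- Orbit maps of basis vectors are locally constant; unitarity makes approximation uniform in `g`,
-- so continuity passes to the closed span.
open Classical in
theorem isStronglyContinuous_repQ (n : ℕ) : IsStronglyContinuous (repQ n) := by
  let S : Submodule ℂ (EllTwo (Set.powersetCard ℚ n)) :=
    { carrier := {f | Continuous fun g : AutQ => repQ n g f}
      add_mem' := fun {a b} (ha : Continuous _) (hb : Continuous _) => by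
        change Continuous fun g : AutQ => repQ n g (a + b)
        simp only [map_add]
        exact ha.add hb
      zero_mem' := by
        change Continuous fun g : AutQ => repQ n g 0
        simpa only [map_zero] using continuous_const
      smul_mem' := fun c a (ha : Continuous _) => by
        change Continuous fun g : AutQ => repQ n g (c • a)
        simp only [map_smul]
        exact ha.const_smul c }
  have hclosed : IsClosed (S : Set (EllTwo (Set.powersetCard ℚ n))) := by
    refine isClosed_of_closure_subset fun f hf => ?_
    refine continuous_of_uniform_approx_of_continuous fun u hu => ?_
    obtain ⟨ε, hε, hεu⟩ := Metric.mem_uniformity_dist.1 hu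
    obtain ⟨f', hf', hd⟩ := Metric.mem_closure_iff.1 hf ε hε
    refine ⟨fun g => repQ n g f', hf', fun g => hεu ?_⟩
    rwa [(repQ n g).dist_map]
  have hsingle : ∀ A : Set.powersetCard ℚ n, lp.single 2 A (1 : ℂ) ∈ S := by
    intro A
    change Continuous fun g : AutQ => repQ n g (lp.single 2 A (1 : ℂ))
    refine IsLocallyConstant.continuous ((IsLocallyConstant.iff_exists_open _).2 fun g => ?_)
    refine ⟨⋂ a ∈ (A : Finset ℚ), {h : AutQ | h a = g a},
      isOpen_biInter_finset fun a _ => isOpen_setOf_apply_eq a (g a), by simp, fun h hh => ?_⟩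
    rw [repQ_single, repQ_single]
    congr 1
    have : g⁻¹ * h ∈ pointStab (A : Finset ℚ) := mem_pointStab.2 fun a ha => by
      have : h a = g a := by simpa using Set.mem_iInter₂.1 hh a ha
      rw [RelIso.mul_apply, this, RelIso.inv_apply_self]
    rw [← smul_eq_iff, mul_smul, inv_smul_eq_iff] at this
    exact this
  intro f
  have hf : f ∈ S := hclosed.mem_of_tendsto (lp.hasSum_single (by norm_num) f)
    (Filter.Eventually.of_forall fun s => S.sum_mem fun A _ => by
      have h := S.smul_mem (f A) (hsingle A)
      rwa [← lp.single_smul, smul_eq_mul, mul_one] at h)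
  exact hf

open Classical in
theorem isIrreducibleRep_repQ (n : ℕ) : IsIrreducibleRep (repQ n) := by
  obtain ⟨s, hs⟩ := Infinite.exists_subset_card_eq ℚ n
  let A₀ : Set.powersetCard ℚ n := ⟨s, hs⟩
  refine ⟨⟨lp.single 2 A₀ (1 : ℂ), 0, fun h => ?_⟩, fun K hK hinv => ?_⟩
  · have := congrArg (fun f : EllTwo (Set.powersetCard ℚ n) => f A₀) h
    simp at this
  have : CompleteSpace K := hK.completeSpace_coe
  have hinv' : ∀ g : AutQ, ∀ w ∈ Kᗮ, repQ n g w ∈ Kᗮ := by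
    intro g w hw
    rw [Submodule.mem_orthogonal] at hw ⊢
    intro u hu
    have h := hw _ (hinv g⁻¹ u hu)
    rw [← (repQ n g).inner_map_map, ← rep_mul_apply, mul_inv_cancel,
      map_one] at h
    exact h
  have hdich : ∀ A : Set.powersetCard ℚ n,
      lp.single 2 A (1 : ℂ) ∈ K ∨ lp.single 2 A (1 : ℂ) ∈ Kᗮ := by
    intro A
    -- The projection `u` of δ_A to `K` is fixed by the stabilizer of `A`, so it is a multiple of
    -- δ_A.
    obtain ⟨u, hu, w, hw, huw⟩ := K.exists_add_mem_mem_orthogonal (lp.single 2 A (1 : ℂ))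
    have hfix : ∀ g ∈ pointStab (A : Finset ℚ), repQ n g u = u := by
      intro g hg
      have h1 : repQ n g u + repQ n g w = u + w := by
        rw [← map_add, ← huw, repQ_single, smul_eq_of_mem_pointStab hg]
      have h2 : repQ n g u - u = w - repQ n g w := by
        rw [sub_eq_sub_iff_add_eq_add, h1, add_comm]
      have h3 : repQ n g u - u ∈ K ⊓ Kᗮ :=
        ⟨K.sub_mem (hinv g u hu) hu, h2 ▸ Kᗮ.sub_mem hw (hinv' g w hw)⟩
      rw [K.inf_orthogonal_eq_bot, Submodule.mem_bot, sub_eq_zero] at h3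
      exact h3
    have hsm := eq_smul_single_of_fixed hfix
    by_cases hc : u A = 0
    · rw [hc, zero_smul] at hsm
      rw [hsm, zero_add] at huw
      exact Or.inr (huw ▸ hw)
    · left
      have h := K.smul_mem (u A)⁻¹ hu
      rwa [hsm, smul_smul, ← hsm, inv_mul_cancel₀ hc, one_smul] at h
  by_cases hex : ∃ A : Set.powersetCard ℚ n, lp.single 2 A (1 : ℂ) ∈ K
  · right
    obtain ⟨A, hA⟩ := hex
    have hall : ∀ B : Set.powersetCard ℚ n, lp.single 2 B (1 : ℂ) ∈ K := by
      intro B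
      obtain ⟨g, rfl⟩ := exists_smul_eq A B
      rw [← repQ_single]
      exact hinv g _ hA
    refine (Submodule.eq_top_iff' ).2 fun f => ?_
    exact hK.mem_of_tendsto (lp.hasSum_single (by norm_num) f)
      (Filter.Eventually.of_forall fun s => K.sum_mem fun B _ => by
        have h := K.smul_mem (f B) (hall B)
        rwa [← lp.single_smul, smul_eq_mul, mul_one] at h)
  · left
    refine (Submodule.eq_bot_iff _).2 fun f hf => ?_
    ext A
    have hA := (hdich A).resolve_left fun h => hex ⟨A, h⟩
    have h := (Submodule.mem_orthogonal' _ _).1 hA f hf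
    rw [lp.inner_single_left] at h
    simpa using h

open Classical in
/-- An intertwiner from `ℓ²(ℚ^[m])` to `ℓ²(ℚ^[n])` forces `n ≤ m`. -/
theorem le_of_areUnitarilyEquivalent {m n : ℕ} (h : AreUnitarilyEquivalent (repQ m) (repQ n)) :
    n ≤ m := by
  obtain ⟨U, hU⟩ := h
  obtain ⟨s, hs⟩ := Infinite.exists_subset_card_eq ℚ m
  let A : Set.powersetCard ℚ m := ⟨s, hs⟩
  have hfix : ∀ g ∈ pointStab s, repQ n g (U (lp.single 2 A (1 : ℂ))) = U (lp.single 2 A 1) := by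
    intro g hg
    rw [← hU, repQ_single, smul_eq_of_mem_pointStab (A := A) hg]
  have hne : U (lp.single 2 A (1 : ℂ)) ≠ 0 := by
    rw [Ne, map_eq_zero_iff U U.injective]
    intro h
    have := congrArg (fun f : EllTwo (Set.powersetCard ℚ m) => f A) h
    simp at this
  obtain ⟨B, hB⟩ : ∃ B, U (lp.single 2 A (1 : ℂ)) B ≠ 0 := by
    by_contra! hz
    exact hne (lp.ext (funext hz))
  have := Finset.card_le_card (subset_of_apply_ne_zero hfix hB)
  rwa [B.2, hs] at this

theorem AreUnitarilyEquivalent.symm {G H H' : Type*} [Group G] [NormedAddCommGroup H]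
    [InnerProductSpace ℂ H] [NormedAddCommGroup H'] [InnerProductSpace ℂ H']
    {π : G →* (H ≃ₗᵢ[ℂ] H)} {ρ : G →* (H' ≃ₗᵢ[ℂ] H')} (h : AreUnitarilyEquivalent π ρ) :
    AreUnitarilyEquivalent ρ π := by
  obtain ⟨U, hU⟩ := h
  refine ⟨U.symm, fun g ξ => U.injective ?_⟩
  rw [hU, U.apply_symm_apply, U.apply_symm_apply]

end EllTwoReps

/-! ### Fixed vectors in closed convex hulls of orbits -/

section UnitaryGroup

variable {G : Type*} [Group G]
variable {H : Type*} [NormedAddCommGroup H] [InnerProductSpace ℂ H]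

/-- The vector `ξ` is fixed by all elements of the subgroup `K`. -/
def IsFixedVector (π : G →* (H ≃ₗᵢ[ℂ] H)) (K : Subgroup G) (ξ : H) : Prop :=
  ∀ g ∈ K, π g ξ = ξ

/-- The closed convex hull of the orbit of `ξ` under the subgroup `K`. -/
def closedHullOrbit (π : G →* (H ≃ₗᵢ[ℂ] H)) (K : Subgroup G) (ξ : H) : Set H :=
  closure (convexHull ℝ ((fun g => π g ξ) '' (K : Set G)))

theorem map_mem_closedHullOrbit (π : G →* (H ≃ₗᵢ[ℂ] H)) (K : Subgroup G) (ξ : H) {k : G}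
    (hk : k ∈ K) {v : H} (hv : v ∈ closedHullOrbit π K ξ) : π k v ∈ closedHullOrbit π K ξ := by
  refine map_mem_closure (π k).continuous hv fun w hw => ?_
  let L : H →ₗ[ℝ] H := (π k).toLinearEquiv.toLinearMap.restrictScalars ℝ
  have h : L w ∈ L '' convexHull ℝ ((fun g => π g ξ) '' (K : Set G)) := ⟨w, hw, rfl⟩
  rw [L.image_convexHull] at h
  refine convexHull_mono ?_ h
  rintro _ ⟨_, ⟨g, hg, rfl⟩, rfl⟩
  refine ⟨k * g, K.mul_mem hk hg, ?_⟩
  change π (k * g) ξ = π k (π g ξ)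
  rw [rep_mul_apply]

/-- The closed convex hull of an orbit of a group of unitaries contains a fixed vector. -/
theorem exists_isFixedVector_mem_closedHullOrbit [CompleteSpace H] (π : G →* (H ≃ₗᵢ[ℂ] H))
    (K : Subgroup G) (ξ : H) : ∃ v ∈ closedHullOrbit π K ξ, IsFixedVector π K v := by
  let : InnerProductSpace ℝ H := InnerProductSpace.complexToReal
  have hconv : Convex ℝ (closedHullOrbit π K ξ) := (convex_convexHull ℝ _).closure
  have hne : (closedHullOrbit π K ξ).Nonempty :=
    ⟨π 1 ξ, subset_closure (subset_convexHull ℝ _ ⟨1, K.one_mem, rfl⟩)⟩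
  obtain ⟨v, hv, hmin⟩ := exists_norm_eq_iInf_of_complete_convex hne
    isClosed_closure.isComplete hconv 0
  refine ⟨v, hv, fun k hk => ?_⟩
  -- The vector `v` of least norm satisfies ⟨-v, w - v⟩ ≤ 0 for `w = π k v`; with ‖w‖ = ‖v‖ this
  -- gives ‖w - v‖² ≤ 0.
  have hle := (norm_eq_iInf_iff_real_inner_le_zero hconv hv).1 hmin _
    (map_mem_closedHullOrbit π K ξ hk hv)
  set w := π k v
  have hw : ‖w‖ = ‖v‖ := (π k).norm_map v
  have h0 := norm_sub_sq_real w v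
  rw [zero_sub, inner_neg_left, inner_sub_right, real_inner_self_eq_norm_sq,
    real_inner_comm] at hle
  rw [hw] at h0
  have h1 : ‖w - v‖ ^ 2 ≤ 0 := by linarith
  have h2 : ‖w - v‖ = 0 := by
    have := sq_nonneg ‖w - v‖
    exact pow_eq_zero_iff (two_ne_zero) |>.1 (le_antisymm h1 this)
  exact sub_eq_zero.1 (norm_eq_zero.1 h2)

theorem inner_map_eq (π : G →* (H ≃ₗᵢ[ℂ] H)) (k g h : G) (ξ η : H) :
    inner ℂ (π (k * g) ξ) (π (k * h) η) = inner ℂ (π g ξ) (π h η) := by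
  rw [rep_mul_apply, rep_mul_apply, (π k).inner_map_map]

end UnitaryGroup

/-! ### Classification of the irreducible representations -/

section Classification

open AutQ

variable {H : Type*} [NormedAddCommGroup H] [InnerProductSpace ℂ H]
  {π : AutQ →* (H ≃ₗᵢ[ℂ] H)}

theorem IsFixedVector.map_eq {ξ : H} {K : Subgroup AutQ} (h : IsFixedVector π K ξ) {g g' : AutQ}
    (hg : g⁻¹ * g' ∈ K) : π g' ξ = π g ξ := by
  have := congrArg (π g) (h _ hg)
  rwa [← rep_mul_apply, mul_inv_cancel_left] at this

/-- A small enough stabilizer moves ξ by less than ‖ξ‖/2, so the closed convex hull of its orbit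
avoids 0 and contains a fixed vector. -/
theorem exists_isFixedVector_ne_zero [CompleteSpace H] [Nontrivial H]
    (hπ : IsStronglyContinuous π) :
    ∃ (A : Finset ℚ) (ξ : H), ξ ≠ 0 ∧ IsFixedVector π (pointStab A) ξ := by
  obtain ⟨ξ, hξ⟩ := exists_ne (0 : H)
  have hpos : 0 < ‖ξ‖ / 2 := half_pos (norm_pos_iff.2 hξ)
  obtain ⟨A, hA⟩ := exists_pointStab_subset
    ((Metric.isOpen_ball (x := ξ) (ε := ‖ξ‖ / 2)).preimage (hπ ξ)) (by simpa using hξ)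
  obtain ⟨v, hv, hfix⟩ := exists_isFixedVector_mem_closedHullOrbit π (pointStab A) ξ
  refine ⟨A, v, ?_, hfix⟩
  have hsub : closedHullOrbit π (pointStab A) ξ ⊆ Metric.closedBall ξ (‖ξ‖ / 2) := by
    refine closure_minimal (convexHull_min ?_ (convex_closedBall _ _)) Metric.isClosed_closedBall
    rintro _ ⟨g, hg, rfl⟩
    exact Metric.ball_subset_closedBall (hA g hg)
  rintro rfl
  have := hsub hv
  rw [Metric.mem_closedBall, dist_zero_left] at this
  linarith

/-- If `C` has no nonzero fixed vectors, then translates of a vector fixed by the stabilizer of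
`C ∪ {a}` under elements of the stabilizer of `C` that move `a` are orthogonal. -/
theorem inner_translate_self_eq_zero [CompleteSpace H] {C : Finset ℚ} {a : ℚ} (ha : a ∉ C)
    (hC : ∀ ζ, IsFixedVector π (pointStab C) ζ → ζ = 0) {ξ : H}
    (hξ : IsFixedVector π (pointStab (insert a C)) ξ) {u : AutQ} (hu : u ∈ pointStab C)
    (hau : a < u a) : inner ℂ (π u ξ) ξ = 0 := by
  set c := inner ℂ (π u ξ) ξ with hc
  -- After translation by g⁻¹, the stabilizer of C ∪ {a} carries g⁻¹ha to ua, and ξ is insensitive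
  -- to the rest.
  have hpair : ∀ g ∈ pointStab C, ∀ h ∈ pointStab C, g a < h a →
      inner ℂ (π h ξ) (π g ξ) = c := by
    intro g hg h hh hgh
    have hgh' : a < (g⁻¹ * h) a := by
      rw [← g.lt_iff_lt, ← RelIso.mul_apply, mul_inv_cancel_left]; exact hgh
    have hmem : g⁻¹ * h ∈ pointStab C := mul_mem (inv_mem hg) hh
    obtain ⟨k, hk, hka⟩ := exists_map_insert C ha hmem hu hgh' hau
    have hkC : k ∈ pointStab C := pointStab_anti (Finset.subset_insert _ _) hk
    have h1 : π (k * (g⁻¹ * h)) ξ = π u ξ := by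
      refine hξ.map_eq (mem_pointStab.2 fun x hx => ?_)
      rcases Finset.mem_insert.1 hx with rfl | hx
      · rw [RelIso.mul_apply, RelIso.mul_apply k, hka, RelIso.inv_apply_self]
      · exact mem_pointStab.1 (mul_mem (inv_mem hu) (mul_mem hkC hmem)) x hx
    have h2 := inner_map_eq π (k * g⁻¹) h g ξ ξ
    rw [← h2, mul_assoc, h1, inv_mul_cancel_right, hξ k hk]
  -- A convex combination of translates pairs to `c` with any translate further to the right than
  -- all of them.
  have hhull : ∀ v ∈ convexHull ℝ ((fun g => π g ξ) '' (pointStab C : Set AutQ)),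
      ∃ g ∈ pointStab C, ∀ h ∈ pointStab C, g a < h a → inner ℂ (π h ξ) v = c := by
    intro v hv
    refine convexHull_min (t := {v | ∃ g ∈ pointStab C, ∀ h ∈ pointStab C, g a < h a →
      inner ℂ (π h ξ) v = c}) ?_ ?_ hv
    · rintro _ ⟨g, hg, rfl⟩
      exact ⟨g, hg, hpair g hg⟩
    · rintro v ⟨g, hg, hgv⟩ w ⟨g', hg', hgw⟩ s t _ _ hst
      obtain ⟨m, hm, hm1, hm2⟩ : ∃ m ∈ pointStab C, g a ≤ m a ∧ g' a ≤ m a := by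
        rcases le_total (g a) (g' a) with h | h
        · exact ⟨g', hg', h, le_rfl⟩
        · exact ⟨g, hg, le_rfl, h⟩
      refine ⟨m, hm, fun h hh hlt => ?_⟩
      rw [inner_add_right, inner_smul_right_eq_smul, inner_smul_right_eq_smul,
        hgv h hh (hm1.trans_lt hlt), hgw h hh (hm2.trans_lt hlt), ← add_smul, hst, one_smul]
  obtain ⟨v, hv, hfix⟩ := exists_isFixedVector_mem_closedHullOrbit π (pointStab C) ξ
  rw [hC v hfix] at hv
  by_contra hne
  have hcpos : 0 < ‖c‖ := norm_pos_iff.2 hne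
  have hξpos : 0 < ‖ξ‖ := norm_pos_iff.2 fun h => hne (by rw [hc, h, inner_zero_right])
  -- The bound ‖c‖/‖ξ‖ is what contradicts Cauchy–Schwarz for ⟨π(gu)ξ, w⟩ = c.
  obtain ⟨w, hw, hd⟩ := Metric.mem_closure_iff.1 hv (‖c‖ / ‖ξ‖) (div_pos hcpos hξpos)
  rw [dist_zero_left, lt_div_iff₀ hξpos] at hd
  obtain ⟨g, hg, hgw⟩ := hhull w hw
  have hcw := hgw (g * u) (mul_mem hg hu) (g.lt_iff_lt.2 hau)
  have hle := norm_inner_le_norm (𝕜 := ℂ) (π (g * u) ξ) w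
  rw [hcw, LinearIsometryEquiv.norm_map] at hle
  linarith [mul_comm ‖ξ‖ ‖w‖]

/-- If no proper subset of `A` has nonzero fixed vectors and `A ⊈ B`, then vectors fixed by the
stabilizers of `A` and of `B` are orthogonal. -/
theorem inner_eq_zero_of_not_subset [CompleteSpace H] {A B : Finset ℚ} (hAB : ¬ A ⊆ B)
    (hA : ∀ C, C ⊂ A → ∀ ζ, IsFixedVector π (pointStab C) ζ → ζ = 0) {ξ η : H}
    (hξ : IsFixedVector π (pointStab A) ξ) (hη : IsFixedVector π (pointStab B) η)
    (hξ1 : ‖ξ‖ = 1) : inner ℂ ξ η = 0 := by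
  obtain ⟨a, haA, haB⟩ := Finset.not_subset.1 hAB
  have haC : a ∉ A.erase a := Finset.notMem_erase a A
  have haU : a ∉ A.erase a ∪ B := by simp [haB]
  -- Powers of `h` fix η and spread ξ into an orthonormal sequence with constant inner product
  -- against η; by Bessel that constant is 0.
  obtain ⟨h, hh, hlt⟩ := exists_lt_apply _ haU
  have hhC := pointStab_anti Finset.subset_union_left hh
  have hhB := pointStab_anti Finset.subset_union_right hh
  have hξ' : IsFixedVector π (pointStab (insert a (A.erase a))) ξ := by
    rwa [Finset.insert_erase haA]
  have horth : ∀ k : ℕ, 0 < k → inner ℂ (π (h ^ k) ξ) ξ = 0 := fun k hk =>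
    inner_translate_self_eq_zero haC (hA _ (Finset.erase_ssubset haA)) hξ' (pow_mem hhC k)
      (lt_pow_apply hlt hk)
  have hlt_orth : ∀ j k : ℕ, j < k → inner ℂ (π (h ^ k) ξ) (π (h ^ j) ξ) = 0 := by
    intro j k hjk
    obtain ⟨d, rfl⟩ := Nat.exists_eq_add_of_lt hjk
    have := inner_map_eq π (h ^ j) (h ^ (d + 1)) 1 ξ ξ
    rw [map_one, LinearIsometryEquiv.coe_one, id, horth _ d.succ_pos, mul_one, ← pow_add] at this
    rwa [add_assoc]
  have hon : Orthonormal ℂ fun k : ℕ => π (h ^ k) ξ := by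
    refine ⟨fun k => by rw [LinearIsometryEquiv.norm_map, hξ1], fun j k hjk => ?_⟩
    rcases lt_or_gt_of_ne hjk with hlt' | hlt'
    · exact inner_eq_zero_symm.1 (hlt_orth j k hlt')
    · exact hlt_orth k j hlt'
  have hconst : ∀ k : ℕ, inner ℂ (π (h ^ k) ξ) η = inner ℂ ξ η := by
    intro k
    nth_rw 1 [← hη _ (pow_mem hhB k)]
    exact (π (h ^ k)).inner_map_map ξ η
  have hs := hon.inner_products_summable (x := η)
  simp only [hconst, summable_const_iff] at hs
  simpa using hs

theorem exists_areUnitarilyEquivalent_repQ [CompleteSpace H] (hπ : IsStronglyContinuous π)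
    (hirr : IsIrreducibleRep π) : ∃ n : ℕ, AreUnitarilyEquivalent π (repQ n) := by
  classical
  have := hirr.1
  have hex : ∃ n : ℕ, ∃ (A : Finset ℚ) (ξ : H), A.card = n ∧ ξ ≠ 0 ∧
      IsFixedVector π (pointStab A) ξ := by
    obtain ⟨A, ξ, h0, h⟩ := exists_isFixedVector_ne_zero hπ
    exact ⟨_, A, ξ, rfl, h0, h⟩
  set n := Nat.find hex
  obtain ⟨A, ξ₀, hcard, hξ₀, hfix₀⟩ := Nat.find_spec hex
  have hmin : ∀ C : Finset ℚ, C.card < n → ∀ ζ, IsFixedVector π (pointStab C) ζ → ζ = 0 := by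
    intro C hC ζ hζ
    by_contra h0
    exact Nat.find_min hex hC ⟨C, ζ, rfl, h0, hζ⟩
  let A₀ : Set.powersetCard ℚ n := ⟨A, hcard⟩
  obtain ⟨ξ, hξ1, hfix⟩ : ∃ ξ : H, ‖ξ‖ = 1 ∧ IsFixedVector π (pointStab A) ξ :=
    ⟨((‖ξ₀‖ : ℂ)⁻¹) • ξ₀, norm_smul_inv_norm hξ₀, fun g hg => by
      rw [map_smul, hfix₀ g hg]⟩
  choose t ht using fun B : Set.powersetCard ℚ n => exists_smul_eq A₀ B
  let v : Set.powersetCard ℚ n → H := fun B => π (t B) ξ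
  -- The choice of `t` is immaterial: two elements sending `A` to the same set differ by an element
  -- fixing `A` pointwise.
  have hv : ∀ (g : AutQ) (B : Set.powersetCard ℚ n), π g (v B) = v (g • B) := by
    intro g B
    change π g (π (t B) ξ) = π (t (g • B)) ξ
    rw [← rep_mul_apply]
    refine hfix.map_eq ((smul_eq_iff (A := A₀)).1 ?_)
    rw [mul_smul, mul_smul, ht, inv_smul_eq_iff, ht]
  have hvfix : ∀ B : Set.powersetCard ℚ n, IsFixedVector π (pointStab (B : Finset ℚ)) (v B) :=
    fun B g hg => by rw [hv, smul_eq_of_mem_pointStab hg]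
  have hon : Orthonormal ℂ v := by
    refine ⟨fun B => by rw [LinearIsometryEquiv.norm_map, hξ1], fun B B' hBB' => ?_⟩
    refine inner_eq_zero_of_not_subset (fun hsub => hBB' (Subtype.ext
      (Finset.eq_of_subset_of_card_le hsub (by rw [B.2, B'.2]))))
      (fun C hC => hmin C ?_) (hvfix B) (hvfix B') (by rw [LinearIsometryEquiv.norm_map, hξ1])
    have := Finset.card_lt_card hC
    rwa [B.2] at this
  let S : Submodule ℂ H := Submodule.span ℂ (Set.range v)
  have hinv : ∀ g : AutQ, ∀ η ∈ S, π g η ∈ S := by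
    intro g η hη
    induction hη using Submodule.span_induction with
    | mem x hx =>
      obtain ⟨B, rfl⟩ := hx
      rw [hv]
      exact Submodule.subset_span ⟨_, rfl⟩
    | zero => rw [map_zero]; exact S.zero_mem
    | add x y _ _ hx hy => rw [map_add]; exact S.add_mem hx hy
    | smul c x _ hx => rw [map_smul]; exact S.smul_mem c hx
  have htop : S.topologicalClosure = ⊤ := by
    refine (hirr.2 S.topologicalClosure S.isClosed_topologicalClosure
      fun g η hη => map_mem_closure (π g).continuous hη (hinv g)).resolve_left fun hbot => ?_
    have h0 : v A₀ ∈ S.topologicalClosure :=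
      S.le_topologicalClosure (Submodule.subset_span ⟨_, rfl⟩)
    rw [hbot, Submodule.mem_bot] at h0
    have := hon.1 A₀
    rw [h0, norm_zero] at this
    exact zero_ne_one this
  let b := HilbertBasis.mk hon htop.ge
  refine ⟨n, b.repr, fun g η => ?_⟩
  ext B
  rw [repQ_apply, b.repr_apply_apply, b.repr_apply_apply, HilbertBasis.coe_mk,
    ← (π g).inner_map_map (v (g⁻¹ • B)), hv, smul_inv_smul]

end Classification

theorem corollaryc :
    (∀ n : ℕ, IsStronglyContinuous (repQ n) ∧ IsIrreducibleRep (repQ n)) ∧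
    (∀ m n : ℕ, AreUnitarilyEquivalent (repQ m) (repQ n) → m = n) ∧
    (∀ (H : Type*) [NormedAddCommGroup H] [InnerProductSpace ℂ H] [CompleteSpace H]
      (π : AutQ →* (H ≃ₗᵢ[ℂ] H)),
      IsStronglyContinuous π → IsIrreducibleRep π →
        ∃ n : ℕ, AreUnitarilyEquivalent π (repQ n)) :=
  ⟨fun n => ⟨isStronglyContinuous_repQ n, isIrreducibleRep_repQ n⟩,
    fun _ _ h => le_antisymm (le_of_areUnitarilyEquivalent h.symm) (le_of_areUnitarilyEquivalent h),
    fun _ _ _ _ _ hπ hirr => exists_areUnitarilyEquivalent_repQ hπ hirr⟩
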